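/- For integers $1 \le k \le n$, a ternary $[n,k]$ code is a $k$-dimensional subspace $C$ of $\mathbb{F}_3^n$. Its minimum weight is the least number of nonzero coordinates of a nonzero vector of $C$, and its dual is $C^\perp=\{x\in\mathbb{F}_3^n \mid \sum_{i=1}^n x_iy_i=0 \text{ for all } y\in C\}$. The code $C$ is linear complementary dual (LCD) if $C\cap C^\perp=\{0\}$. Let $d_3(n,k)$ denote the largest minimum weight among all ternary LCD $[n,k]$ codes. **Theorem.** Let $n\ge 4$ be an integer. If $n \equiv 4,5,7,8,10,11,14,16,17,19,20,24,26,29,30,33,35,36,38,39 \pmod{40}$, then $$d_3(n,4)=\left\lfloor \frac{27n}{40}\right\rfloor-1.$$ If $n\equiv 6 \pmod{40}$, then $$d_3(n,4)=\left\lfloor \frac{27n}{40}\right\rfloor-2.$$ -/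

import Mathlib

/-- A linear code of length `n` over `F` is a subspace of `F ^ n`. -/
abbrev LinearCode (F : Type*) [Field F] (n : ℕ) : Type _ := Submodule F (Fin n → F)

namespace LinearCode

variable {F : Type*} [Field F] {n : ℕ}

/-- The dual code `{x | ⟨x, y⟩ = 0 for all y ∈ C}`, where `⟨x, y⟩ = ∑ i, x i * y i`. -/
def dual (C : LinearCode F n) : LinearCode F n where
  carrier := {x | ∀ y ∈ C, ∑ i, x i * y i = 0}
  zero_mem' := by
    intro y _
    simp
  add_mem' := by
    intro a b ha hb y hy
    simp [add_mul, Finset.sum_add_distrib, ha y hy, hb y hy]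
  smul_mem' := by
    intro c a ha y hy
    simp [mul_assoc, ← Finset.mul_sum, ha y hy]

/-- A code is linear complementary dual if it meets its dual trivially. -/
def IsLCD (C : LinearCode F n) : Prop := C ⊓ C.dual = ⊥

/-- The minimum weight: the least number of nonzero coordinates of a nonzero codeword
(with the value `0` for the zero code, which has no nonzero codeword). -/
noncomputable def minWeight [DecidableEq F] (C : LinearCode F n) : ℕ :=
  sInf {w | ∃ x ∈ C, x ≠ 0 ∧ hammingNorm x = w}

end LinearCode

/-- The minimum weights of the LCD `[n, k]` codes over `F`. -/
def lcdMinWeights (F : Type*) [Field F] [DecidableEq F] (n k : ℕ) : Set ℕ :=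
  {d | ∃ C : LinearCode F n, Module.finrank F C = k ∧ C.IsLCD ∧ C.minWeight = d}

/-- `d_q(n, k)`: the largest minimum weight among all LCD `[n, k]` codes over the field `F`
with `q` elements. -/
noncomputable def largestLCDMinWeight (F : Type*) [Field F] [DecidableEq F] (n k : ℕ) : ℕ :=
  sSup (lcdMinWeights F n k)

/-- Minimum weights are at most the length. -/
theorem bddAbove_lcdMinWeights (F : Type*) [Field F] [DecidableEq F] (n k : ℕ) :
    BddAbove (lcdMinWeights F n k) := by
  refine ⟨n, ?_⟩
  rintro d ⟨C, -, -, rfl⟩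
  unfold LinearCode.minWeight
  rcases Set.eq_empty_or_nonempty {w | ∃ x ∈ C, x ≠ 0 ∧ hammingNorm x = w} with h | h
  · rw [h]
    simp
  · obtain ⟨x, -, -, hx⟩ := Nat.sInf_mem h
    rw [← hx]
    simpa using hammingNorm_le_card_fintype (x := x)

/-- A nonzero value of `largestLCDMinWeight` is attained and is a genuine maximum. -/
theorem isGreatest_largestLCDMinWeight (F : Type*) [Field F] [DecidableEq F] (n k : ℕ)
    (h : largestLCDMinWeight F n k ≠ 0) :
    IsGreatest (lcdMinWeights F n k) (largestLCDMinWeight F n k) := by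
  have hne : (lcdMinWeights F n k).Nonempty := by
    by_contra hc
    rw [Set.not_nonempty_iff_eq_empty] at hc
    exact h (by simp [largestLCDMinWeight, hc])
  exact ⟨Nat.sSup_mem hne (bddAbove_lcdMinWeights F n k),
    fun d hd => le_csSup (bddAbove_lcdMinWeights F n k) hd⟩

/-! Upper bound. The standard form on an LCD code is nondegenerate, so an orthogonal basis exists.
As nonzero squares in `ZMod 3` equal 1, weights modulo 3 are the values of a diagonal form Q of rank
four. If all nonzero weights are at least d, each exceeds d by at least the residue of Q(x) - d
modulo 3. The weights sum to at most 54n, and the sum of residues depends only on d modulo 3 and the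
discriminant of Q; this gives `LinearCode.IsLCD.weight_bound`, which excludes the floor of 27n/40 in
the listed classes.

For n = 40s + 6 and d = 27s + 3 that inequality leaves room. Write each nonzero weight as d +
residue + 3b(x). Divisibility by 9 of weight sums off hyperplanes gives ∑ b(x)(x·p)² = Q(p) for all
p, while ∑ b ≤ 4. Then b lives on at most two pairs ±u, ±v, too few to carry a form of rank four.

Lower bound. An explicit code is given for each residue class; adjoining copies of the simplex code
adds 40 to the length and 27 to every nonzero weight, leaving the Gram matrix unchanged modulo 3. -/

open Finset Matrix

/-! ### Weights modulo 3 as a quadratic form -/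

/-- The weight of the codeword `x G`, where `G` is the generator matrix with columns `g k`. -/
def columnWeight {n : ℕ} (g : Fin n → Fin 4 → ZMod 3) (x : Fin 4 → ZMod 3) : ℕ :=
  #{k | x ⬝ᵥ g k ≠ 0}

theorem zmod_three_ite_ne_zero (a : ZMod 3) : (if a ≠ 0 then 1 else 0 : ZMod 3) = a * a := by
  revert a; decide

theorem columnWeight_cast {n : ℕ} (g : Fin n → Fin 4 → ZMod 3) (x : Fin 4 → ZMod 3) :
    (columnWeight g x : ZMod 3) = ∑ i, ∑ j, x i * x j * ∑ k, g k i * g k j := by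
  have h : (columnWeight g x : ZMod 3) = ∑ k, (x ⬝ᵥ g k) * (x ⬝ᵥ g k) := by
    simp only [columnWeight, card_filter, Nat.cast_sum, Nat.cast_ite, Nat.cast_one, Nat.cast_zero,
      zmod_three_ite_ne_zero]
  simp only [h, dotProduct, Finset.sum_mul_sum]
  rw [Finset.sum_comm]
  refine Finset.sum_congr rfl fun i _ => ?_
  rw [Finset.sum_comm]
  refine Finset.sum_congr rfl fun j _ => ?_
  rw [Finset.mul_sum]
  exact Finset.sum_congr rfl fun k _ => by ring

theorem columnWeight_zero {n : ℕ} (g : Fin n → Fin 4 → ZMod 3) : columnWeight g 0 = 0 := by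
  simp [columnWeight]

theorem columnWeight_neg {n : ℕ} (g : Fin n → Fin 4 → ZMod 3) (x : Fin 4 → ZMod 3) :
    columnWeight g (-x) = columnWeight g x := by
  simp [columnWeight]

/-- The standard bilinear form restricted to a code. -/
def LinearCode.form {n : ℕ} (C : LinearCode (ZMod 3) n) : LinearMap.BilinForm (ZMod 3) C :=
  LinearMap.mk₂ (ZMod 3) (fun x y => (x : Fin n → ZMod 3) ⬝ᵥ (y : Fin n → ZMod 3))
    (by simp) (by simp) (by simp) (by simp)

theorem LinearCode.form_apply {n : ℕ} (C : LinearCode (ZMod 3) n) (x y : C) :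
    C.form x y = (x : Fin n → ZMod 3) ⬝ᵥ (y : Fin n → ZMod 3) := rfl

theorem LinearCode.form_isSymm {n : ℕ} (C : LinearCode (ZMod 3) n) :
    LinearMap.IsSymm C.form :=
  ⟨fun x y => by simp [form_apply, dotProduct_comm]⟩

theorem LinearCode.IsLCD.eq_zero {n : ℕ} {C : LinearCode (ZMod 3) n} (hC : C.IsLCD) (x : C)
    (h : ∀ y, C.form x y = 0) : x = 0 := by
  have hx : (x : Fin n → ZMod 3) ∈ C ⊓ C.dual := ⟨x.2, fun y hy => h ⟨y, hy⟩⟩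
  rw [hC, Submodule.mem_bot] at hx
  exact Subtype.ext hx

/-- An LCD code has an orthogonal basis, so its weights are given modulo `3` by a diagonal
quadratic form. -/
theorem LinearCode.IsLCD.exists_columns {n : ℕ} {C : LinearCode (ZMod 3) n} (hC : C.IsLCD)
    (hk : Module.finrank (ZMod 3) C = 4) :
    ∃ (g : Fin n → Fin 4 → ZMod 3) (ε : Fin 4 → ZMod 3), (∀ i, ε i ≠ 0) ∧
      (∀ x, (columnWeight g x : ZMod 3) = ∑ i, ε i * x i ^ 2) ∧
      ∀ x, x ≠ 0 → C.minWeight ≤ columnWeight g x := by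
  have : Invertible (2 : ZMod 3) := ⟨2, by decide, by decide⟩
  obtain ⟨v', hv'⟩ := LinearMap.BilinForm.exists_orthogonal_basis C.form_isSymm
  let v : Module.Basis (Fin 4) (ZMod 3) C := v'.reindex (finCongr hk)
  have hv : ∀ i j, i ≠ j → C.form (v i) (v j) = 0 := by
    intro i j hij
    have := hv' (i := (finCongr hk).symm i) (j := (finCongr hk).symm j) (by simpa using hij)
    simpa [v] using this
  -- An isotropic basis vector would be orthogonal to the whole code.
  have hvv : ∀ i, C.form (v i) (v i) ≠ 0 := by
    intro i hi
    refine v.ne_zero i (hC.eq_zero _ fun y => ?_)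
    rw [← v.sum_repr y, map_sum]
    refine Finset.sum_eq_zero fun j _ => ?_
    rw [map_smul]
    by_cases hij : i = j
    · subst hij; simp [hi]
    · simp [hv i j hij]
  refine ⟨fun k i => (v i : Fin n → ZMod 3) k, fun i => C.form (v i) (v i), hvv, fun x => ?_,
    fun x hx => ?_⟩
  · rw [columnWeight_cast]
    refine Finset.sum_congr rfl fun i _ => ?_
    rw [Finset.sum_eq_single i]
    · simp only [form_apply, dotProduct]; ring
    · intro j _ hji
      have := hv i j hji.symm
      rw [form_apply, dotProduct] at this
      rw [this, mul_zero]
    · simp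
  · refine Nat.sInf_le ⟨(∑ i, x i • v i : C), Submodule.coe_mem _, ?_, ?_⟩
    · intro h0
      refine hx (funext fun i => ?_)
      exact Fintype.linearIndependent_iff.1 v.linearIndependent x (Subtype.ext h0) i
    · simp [hammingNorm, columnWeight, dotProduct]

/-! ### Counting vectors off hyperplanes -/

/-- The set is a union of cosets of the kernel, whose dimension is at least 4 - m. -/
theorem three_pow_dvd_card_filter_linearMap {m : ℕ}
    (f : (Fin 4 → ZMod 3) →ₗ[ZMod 3] (Fin m → ZMod 3)) (S : (Fin m → ZMod 3) → Prop)
    [DecidablePred S] : 3 ^ (4 - m) ∣ #{x | S (f x)} := by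
  rw [Finset.card_eq_sum_card_fiberwise (f := f) (t := univ) (by simp)]
  refine Finset.dvd_sum fun y _ => ?_
  rw [filter_filter]
  by_cases hy : S y ∧ y ∈ Set.range f
  · obtain ⟨hS, hr⟩ := hy
    have h1 : #{x | S (f x) ∧ f x = y} = #{x | f x = 0} := by
      rw [← AddMonoidHom.card_fiber_eq_of_mem_range f hr ⟨0, map_zero f⟩]
      congr 1
      ext x
      simp only [mem_filter, mem_univ, true_and, and_iff_right_iff_imp]
      rintro rfl
      exact hS
    have h2 : #{x | f x = 0} = 3 ^ Module.finrank (ZMod 3) (LinearMap.ker f) := by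
      have := Module.natCard_eq_pow_finrank (K := ZMod 3) (V := LinearMap.ker f)
      rw [Nat.card_zmod] at this
      rw [← this]
      exact (Nat.subtype_card _ (by simp)).symm
    rw [h1, h2]
    refine pow_dvd_pow 3 ?_
    have h3 := f.finrank_range_add_finrank_ker
    have h4 := (LinearMap.range f).finrank_le
    simp only [Module.finrank_fin_fun] at h3 h4
    omega
  · rw [Finset.card_eq_zero.2 (Finset.filter_eq_empty_iff.2 _)]
    · exact dvd_zero _
    · rintro x - ⟨h1, rfl⟩
      exact hy ⟨h1, x, rfl⟩

/-- The number of vectors off a hyperplane. -/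
theorem card_dotProduct_ne_zero_le (c : Fin 4 → ZMod 3) :
    #{x : Fin 4 → ZMod 3 | x ⬝ᵥ c ≠ 0} ≤ 54 := by
  have h1 := three_pow_dvd_card_filter_linearMap (Matrix.of ![c]).mulVecLin (fun y => y 0 = 0)
  have h2 := Finset.card_filter_add_card_filter_not (s := (univ : Finset (Fin 4 → ZMod 3)))
    (fun x => x ⬝ᵥ c = 0)
  have h3 : 0 < #{x : Fin 4 → ZMod 3 | x ⬝ᵥ c = 0} :=
    Finset.card_pos.2 ⟨0, by simp⟩
  have h4 : #(univ : Finset (Fin 4 → ZMod 3)) = 81 := by simp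
  simp only [Matrix.mulVecLin_apply, Matrix.mulVec, Matrix.of_apply, Matrix.cons_val_zero,
    dotProduct_comm c] at h1
  have h5 := Nat.le_of_dvd h3 h1
  norm_num at h5
  simp only [ne_eq]
  omega

/-- Vectors off two hyperplanes come in cosets of the intersection of these. -/
theorem nine_dvd_card_dotProduct_ne_zero (p c : Fin 4 → ZMod 3) :
    9 ∣ #{x : Fin 4 → ZMod 3 | x ⬝ᵥ p ≠ 0 ∧ x ⬝ᵥ c ≠ 0} := by
  have h1 := three_pow_dvd_card_filter_linearMap (Matrix.of ![p, c]).mulVecLin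
    (fun y => y 0 ≠ 0 ∧ y 1 ≠ 0)
  simpa [Matrix.mulVec, dotProduct_comm] using h1

theorem sum_columnWeight_le {n : ℕ} (g : Fin n → Fin 4 → ZMod 3) :
    ∑ x, columnWeight g x ≤ 54 * n := by
  simp only [columnWeight, card_filter]
  rw [Finset.sum_comm]
  refine (Finset.sum_le_card_nsmul _ _ 54 fun k _ => ?_).trans (by simp [mul_comm])
  rw [← card_filter]
  exact card_dotProduct_ne_zero_le _

theorem nine_dvd_sum_columnWeight {n : ℕ} (g : Fin n → Fin 4 → ZMod 3) (p : Fin 4 → ZMod 3) :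
    9 ∣ ∑ x with x ⬝ᵥ p ≠ 0, columnWeight g x := by
  simp only [columnWeight, card_filter]
  rw [Finset.sum_comm]
  refine Finset.dvd_sum fun k _ => ?_
  rw [← card_filter, filter_filter]
  exact nine_dvd_card_dotProduct_ne_zero _ _

/-! ### Residue sums of diagonal quaternary forms -/

/-- The sum of `f` over `{0, 1, 2} ^ 4`, in a form on which the kernel computes fast. -/
def ternarySum (f : ℕ → ℕ → ℕ → ℕ → ℕ) : ℕ :=
  let s (h : ℕ → ℕ) : ℕ := h 0 + h 1 + h 2
  s fun a => s fun b => s fun c => s fun d => f a b c d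

theorem sum_eq_ternarySum (f : ℕ → ℕ → ℕ → ℕ → ℕ) :
    ∑ x : Fin 4 → ZMod 3, f (x 0).val (x 1).val (x 2).val (x 3).val = ternarySum f := by
  let e : (Fin 4 → ZMod 3) ≃ ZMod 3 × ZMod 3 × ZMod 3 × ZMod 3 :=
    { toFun := fun x => (x 0, x 1, x 2, x 3)
      invFun := fun p => ![p.1, p.2.1, p.2.2.1, p.2.2.2]
      left_inv := fun x => by ext i; fin_cases i <;> rfl
      right_inv := fun p => rfl }
  have h3 : ∀ h : ZMod 3 → ℕ, ∑ a, h a = h 0 + h 1 + h 2 := Fin.sum_univ_three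
  refine (Fintype.sum_equiv e _ (fun p => f p.1.val p.2.1.val p.2.2.1.val p.2.2.2.val)
    fun x => rfl).trans ?_
  simp only [Fintype.sum_prod_type, h3]
  rfl

/-- The least nonnegative residue modulo `3` of `∑ eᵢ xᵢ ^ 2 - d`. -/
def formResidue (e₀ e₁ e₂ e₃ d x₀ x₁ x₂ x₃ : ℕ) : ℕ :=
  (e₀ * x₀ ^ 2 + e₁ * x₁ ^ 2 + e₂ * x₂ ^ 2 + e₃ * x₃ ^ 2 + 2 * d) % 3

/-- The discriminant decides the type: Q takes the values 0, 1, 2 with multiplicities 33, 24, 24 if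
it is 1, and 21, 30, 30 otherwise. -/
theorem ternarySum_formResidue : ∀ a ∈ [1, 2], ∀ b ∈ [1, 2], ∀ c ∈ [1, 2], ∀ d ∈ [1, 2],
    ternarySum (formResidue a b c d 0) = (if a * b * c * d % 3 = 1 then 72 else 90) ∧
    72 ≤ ternarySum (formResidue a b c d 1) ∧ ternarySum (formResidue a b c d 2) = 81 := by
  decide +kernel

/-- The squared factor is the indicator of x·p ≠ 0: off the hyperplane of p, the residues of Q sum
to -3Q(p) modulo 9. -/
theorem nine_dvd_ternarySum_formResidue :
    ∀ a ∈ [1, 2], ∀ b ∈ [1, 2], ∀ c ∈ [1, 2], ∀ d ∈ [1, 2], a * b * c * d % 3 = 1 →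
    ∀ p < 3, ∀ q < 3, ∀ r < 3, ∀ s < 3,
    9 ∣ ternarySum (fun x y z w => (x * p + y * q + z * r + w * s) ^ 2 % 3 *
      formResidue a b c d 0 x y z w) + 3 * (a * p ^ 2 + b * q ^ 2 + c * r ^ 2 + d * s ^ 2) := by
  decide +kernel

/-- The least nonnegative residue modulo `3` of `∑ ε i * x i ^ 2 - d`. -/
def weightResidue (ε : Fin 4 → ZMod 3) (d : ℕ) (x : Fin 4 → ZMod 3) : ℕ :=
  formResidue (ε 0).val (ε 1).val (ε 2).val (ε 3).val (d % 3)
    (x 0).val (x 1).val (x 2).val (x 3).val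

theorem weightResidue_cast (ε : Fin 4 → ZMod 3) (d : ℕ) (x : Fin 4 → ZMod 3) :
    (weightResidue ε d x : ZMod 3) = ∑ i, ε i * x i ^ 2 - d := by
  have h2 : (2 : ZMod 3) = -1 := by decide
  simp [weightResidue, formResidue, Fin.sum_univ_four, ZMod.natCast_mod]
  rw [h2]
  ring

theorem weightResidue_lt (ε : Fin 4 → ZMod 3) (d : ℕ) (x : Fin 4 → ZMod 3) :
    weightResidue ε d x < 3 := Nat.mod_lt _ (by norm_num)

theorem weightResidue_zero (ε : Fin 4 → ZMod 3) (d : ℕ) :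
    weightResidue ε d 0 = 2 * d % 3 := by
  simp [weightResidue, formResidue]

theorem sum_weightResidue (ε : Fin 4 → ZMod 3) (d : ℕ) : ∑ x, weightResidue ε d x =
    ternarySum (formResidue (ε 0).val (ε 1).val (ε 2).val (ε 3).val (d % 3)) :=
  sum_eq_ternarySum _

theorem zmod_three_val_mem {a : ZMod 3} (ha : a ≠ 0) : a.val ∈ [1, 2] := by
  revert a; decide

theorem add_weightResidue_le {ε : Fin 4 → ZMod 3} {d w : ℕ} {x : Fin 4 → ZMod 3}
    (hw : (w : ZMod 3) = ∑ i, ε i * x i ^ 2) (hd : d ≤ w) :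
    ∃ b, w = d + weightResidue ε d x + 3 * b := by
  have h1 : ((d + weightResidue ε d x : ℕ) : ZMod 3) = (w : ℕ) := by
    rw [Nat.cast_add, weightResidue_cast, hw]; ring
  have h2 := (ZMod.natCast_eq_natCast_iff' _ _ _).1 h1
  have h3 := weightResidue_lt ε d x
  exact ⟨(w - (d + weightResidue ε d x)) / 3, by omega⟩

/-! ### Excess weights and upper bounds -/

/-- The sum of the excesses of the weights over the bound forced by their residues. -/
theorem exists_excess {n d : ℕ} {g : Fin n → Fin 4 → ZMod 3} {ε : Fin 4 → ZMod 3}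
    (hε : ∀ x, (columnWeight g x : ZMod 3) = ∑ i, ε i * x i ^ 2)
    (hd : ∀ x, x ≠ 0 → d ≤ columnWeight g x) :
    ∃ b : (Fin 4 → ZMod 3) → ℕ, b 0 = 0 ∧
      (∀ x, x ≠ 0 → columnWeight g x = d + weightResidue ε d x + 3 * b x) ∧
      80 * d + ∑ x, weightResidue ε d x + 3 * ∑ x, b x ≤ 54 * n + 2 * d % 3 := by
  have h : ∀ x, ∃ b, (x = 0 → b = 0) ∧
      (x ≠ 0 → columnWeight g x = d + weightResidue ε d x + 3 * b) := by
    intro x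
    by_cases hx : x = 0
    · exact ⟨0, fun _ => rfl, fun h => absurd hx h⟩
    · obtain ⟨b, hb⟩ := add_weightResidue_le (hε x) (hd x hx)
      exact ⟨b, fun h => absurd h hx, fun _ => hb⟩
  choose b hb0 hb using h
  refine ⟨b, hb0 0 rfl, hb, ?_⟩
  have h1 := sum_columnWeight_le g
  -- The zero vector has weight 0; the `if` supplies what the right side counts there.
  have h2 : ∑ x, (columnWeight g x + if x = 0 then d + 2 * d % 3 else 0) =
      ∑ x, (d + weightResidue ε d x + 3 * b x) := by
    refine Finset.sum_congr rfl fun x _ => ?_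
    by_cases hx : x = 0
    · subst hx
      simp [columnWeight_zero, weightResidue_zero, hb0 0 rfl]
    · simp [hx, hb x hx]
  have h4 : Fintype.card (Fin 4 → ZMod 3) = 81 := by simp
  simp only [Finset.sum_add_distrib, ← Finset.mul_sum, Finset.sum_ite_eq', Finset.mem_univ,
    if_true, Finset.sum_const, Finset.card_univ, h4, smul_eq_mul] at h2
  omega

/-- Both the weight sum off the hyperplane of p and d times the number of its terms vanish modulo 9.
What remains, residues plus 3b, makes the b sum cancel -Q(p) modulo 3. -/
theorem excess_dual_form {n d : ℕ} {g : Fin n → Fin 4 → ZMod 3} {ε : Fin 4 → ZMod 3}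
    (hε0 : ∀ i, ε i ≠ 0) (hd : 3 ∣ d)
    (hhyp : ∑ x, weightResidue ε d x = 72) {b : (Fin 4 → ZMod 3) → ℕ}
    (hb : ∀ x, x ≠ 0 → columnWeight g x = d + weightResidue ε d x + 3 * b x)
    (p : Fin 4 → ZMod 3) :
    ∑ x, (b x : ZMod 3) * (x ⬝ᵥ p) ^ 2 = ∑ i, ε i * p i ^ 2 := by
  have hd0 : d % 3 = 0 := by omega
  have h0 : (ε 0).val * (ε 1).val * (ε 2).val * (ε 3).val % 3 = 1 := by
    have := (ternarySum_formResidue _ (zmod_three_val_mem (hε0 0)) _ (zmod_three_val_mem (hε0 1))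
      _ (zmod_three_val_mem (hε0 2)) _ (zmod_three_val_mem (hε0 3))).1
    rw [sum_weightResidue, hd0, this] at hhyp
    by_contra hne
    rw [if_neg hne] at hhyp
    omega
  have h1 := nine_dvd_ternarySum_formResidue _ (zmod_three_val_mem (hε0 0)) _
    (zmod_three_val_mem (hε0 1)) _ (zmod_three_val_mem (hε0 2)) _ (zmod_three_val_mem (hε0 3)) h0
    _ (ZMod.val_lt (p 0)) _ (ZMod.val_lt (p 1)) _ (ZMod.val_lt (p 2)) _ (ZMod.val_lt (p 3))
  rw [← sum_eq_ternarySum] at h1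
  have hsq : ∀ a : ZMod 3, (a ^ 2).val = if a ≠ 0 then 1 else 0 := by decide
  have h2 : ∀ x : Fin 4 → ZMod 3, ((x 0).val * (p 0).val + (x 1).val * (p 1).val +
      (x 2).val * (p 2).val + (x 3).val * (p 3).val) ^ 2 % 3 = if x ⬝ᵥ p ≠ 0 then 1 else 0 := by
    intro x
    rw [← hsq, ← ZMod.val_natCast]
    simp [dotProduct, Fin.sum_univ_four]
  simp only [h2, ite_mul, one_mul, zero_mul, ← Finset.sum_filter] at h1
  have h3 := nine_dvd_sum_columnWeight g p
  have h4 : ∑ x with x ⬝ᵥ p ≠ 0, columnWeight g x =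
      #{x : Fin 4 → ZMod 3 | x ⬝ᵥ p ≠ 0} * d + ∑ x with x ⬝ᵥ p ≠ 0, weightResidue ε d x
        + 3 * ∑ x with x ⬝ᵥ p ≠ 0, b x := by
    rw [Finset.mul_sum, ← smul_eq_mul (#_), ← Finset.sum_const, ← Finset.sum_add_distrib,
      ← Finset.sum_add_distrib]
    refine Finset.sum_congr rfl fun x hx => hb x ?_
    rintro rfl
    simp at hx
  have h5 : 9 ∣ #{x : Fin 4 → ZMod 3 | x ⬝ᵥ p ≠ 0} * d := by
    have := nine_dvd_card_dotProduct_ne_zero p p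
    simp only [and_self] at this
    exact this.mul_right d
  have h6 : ∑ x with x ⬝ᵥ p ≠ 0, weightResidue ε d x = ∑ x with x ⬝ᵥ p ≠ 0,
      formResidue (ε 0).val (ε 1).val (ε 2).val (ε 3).val 0
        (x 0).val (x 1).val (x 2).val (x 3).val := by
    simp only [weightResidue, hd0]
  rw [h6] at h4
  have h7 : (∑ x with x ⬝ᵥ p ≠ 0, b x) % 3 = ((ε 0).val * (p 0).val ^ 2 +
      (ε 1).val * (p 1).val ^ 2 + (ε 2).val * (p 2).val ^ 2 + (ε 3).val * (p 3).val ^ 2) % 3 := by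
    omega
  have h8 := (ZMod.natCast_eq_natCast_iff' _ _ 3).2 h7
  have hsq' : ∀ a : ZMod 3, (if a ≠ 0 then 1 else 0 : ZMod 3) = a ^ 2 := by decide
  have h9 : ((∑ x with x ⬝ᵥ p ≠ 0, b x : ℕ) : ZMod 3) =
      ∑ x, (b x : ZMod 3) * (x ⬝ᵥ p) ^ 2 := by
    simp only [← hsq', mul_ite, mul_one, mul_zero, ← Finset.sum_filter, Nat.cast_sum]
  rw [← h9, h8]
  simp [Fin.sum_univ_four]

/-- Two points of the projective space do not carry a form of rank four. -/
theorem false_of_excess_le_four {ε : Fin 4 → ZMod 3} (hε0 : ∀ i, ε i ≠ 0)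
    {b : (Fin 4 → ZMod 3) → ℕ} (hb0 : b 0 = 0) (hneg : ∀ x, b (-x) = b x)
    (hsum : ∑ x, b x ≤ 4)
    (h : ∀ p, ∑ x, (b x : ZMod 3) * (x ⬝ᵥ p) ^ 2 = ∑ i, ε i * p i ^ 2) : False := by
  have hself : ∀ x, b x ≠ 0 → x ≠ -x := by
    intro x hx hxx
    have : ∀ a : ZMod 3, a = -a → a = 0 := by decide
    have hx0 : x = 0 := funext fun i => this _ (congrFun hxx i)
    exact hx (hx0 ▸ hb0)
  obtain ⟨u, v, huv⟩ : ∃ u v, ∀ x, b x ≠ 0 → x = u ∨ x = -u ∨ x = v ∨ x = -v := by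
    -- Otherwise b is positive at the five distinct points w, ±u, ±v, so its sum exceeds 4.
    by_contra! hcon
    obtain ⟨u, hu, -⟩ := hcon 0 0
    obtain ⟨v, hv, hv1, hv2, -⟩ := hcon u u
    obtain ⟨w, hw, hw1, hw2, hw3, hw4⟩ := hcon u v
    have hle : ∑ x ∈ ({w, u, -u, v, -v} : Finset (Fin 4 → ZMod 3)), b x ≤ ∑ x, b x :=
      Finset.sum_le_sum_of_subset (Finset.subset_univ _)
    have h1 := hself u hu
    have h2 := hself v hv
    have h3 : u ≠ v := hv1.symm
    have h4 : u ≠ -v := fun h => hv2 (by rw [h, neg_neg])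
    have h5 : -u ≠ v := hv2.symm
    have h6 : -u ≠ -v := fun h => h3 (neg_injective h)
    rw [Finset.sum_insert (by simp [*]), Finset.sum_insert (by simp [h1, h3, h4]),
      Finset.sum_insert (by simp only [mem_insert, mem_singleton, h5, h6, or_self,
        not_false_eq_true]), Finset.sum_insert (by simpa using h2), Finset.sum_singleton,
      hneg, hneg] at hle
    omega
  obtain ⟨y, hy, hy0⟩ : ∃ y, (Matrix.of ![u, v]).mulVecLin y = 0 ∧ y ≠ 0 := by
    have := LinearMap.ker_ne_bot_of_finrank_lt (f := (Matrix.of ![u, v]).mulVecLin) (by simp)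
    obtain ⟨y, hy, hy0⟩ := Submodule.exists_mem_ne_zero_of_ne_bot this
    exact ⟨y, hy, hy0⟩
  have hyu : u ⬝ᵥ y = 0 := by simpa [Matrix.mulVec] using congrFun hy 0
  have hyv : v ⬝ᵥ y = 0 := by simpa [Matrix.mulVec] using congrFun hy 1
  -- Translation by y fixes every x·p with b(x) ≠ 0, so y lies in the radical of Q.
  have hinv : ∀ p, ∑ i, ε i * (p + y) i ^ 2 = ∑ i, ε i * p i ^ 2 := by
    intro p
    rw [← h, ← h]
    refine Finset.sum_congr rfl fun x _ => ?_
    by_cases hx : b x = 0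
    · simp [hx]
    · have : x ⬝ᵥ y = 0 := by
        rcases huv x hx with rfl | rfl | rfl | rfl <;> simp [hyu, hyv]
      rw [dotProduct_add, this, add_zero]
  refine hy0 (funext fun i => ?_)
  have h1 := hinv (Pi.single i 1)
  have h2 := hinv 0
  have h3 : ∑ j, ε j * ((Pi.single i 1 : Fin 4 → ZMod 3) + y) j ^ 2 =
      ∑ j, ε j * (Pi.single i 1 : Fin 4 → ZMod 3) j ^ 2 + ∑ j, ε j * ((0 : Fin 4 → ZMod 3) + y) j ^ 2
        + 2 * (ε i * y i) := by
    have : 2 * (ε i * y i) =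
        ∑ j, 2 * (ε j * y j) * (Pi.single i 1 : Fin 4 → ZMod 3) j := by
      simp [Pi.single_apply]
    rw [this, ← Finset.sum_add_distrib, ← Finset.sum_add_distrib]
    exact Finset.sum_congr rfl fun j _ => by simp only [Pi.add_apply, Pi.zero_apply]; ring
  rw [h3, h2] at h1
  have h4 : 2 * (ε i * y i) = 0 := by simpa using h1
  have h5 : (2 : ZMod 3) ≠ 0 := by decide
  simpa [h5, hε0 i] using h4

/-- The parameters excluded by the residues of the weights. -/
theorem LinearCode.IsLCD.weight_bound {n : ℕ} {C : LinearCode (ZMod 3) n} (hC : C.IsLCD)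
    (hk : Module.finrank (ZMod 3) C = 4) {d : ℕ} (hd : d ≤ C.minWeight) :
    80 * d + (if d % 3 = 0 then 72 else if d % 3 = 1 then 70 else 80) ≤ 54 * n := by
  obtain ⟨g, ε, hε0, hε, hg⟩ := hC.exists_columns hk
  obtain ⟨b, -, -, hsum⟩ := exists_excess hε fun x hx => hd.trans (hg x hx)
  -- The constants are the least residue sum minus the residue at zero: 72 - 0, 72 - 2, 81 - 1.
  have h1 := ternarySum_formResidue _ (zmod_three_val_mem (hε0 0)) _ (zmod_three_val_mem (hε0 1))
      _ (zmod_three_val_mem (hε0 2)) _ (zmod_three_val_mem (hε0 3))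
  rw [sum_weightResidue] at hsum
  have h3 : d % 3 = 0 ∨ d % 3 = 1 ∨ d % 3 = 2 := by omega
  rcases h3 with h3 | h3 | h3 <;> rw [h3] at hsum ⊢ <;> split_ifs at h1 <;>
    simp only [↓reduceIte, one_ne_zero, OfNat.ofNat_ne_zero, OfNat.ofNat_ne_one] <;> omega

/-- The parameters excluded by the divisibility of the sums of weights off a hyperplane. -/
theorem LinearCode.IsLCD.minWeight_lt {s : ℕ} {C : LinearCode (ZMod 3) (40 * s + 6)}
    (hC : C.IsLCD) (hk : Module.finrank (ZMod 3) C = 4) : C.minWeight < 27 * s + 3 := by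
  by_contra! hd
  obtain ⟨g, ε, hε0, hε, hg⟩ := hC.exists_columns hk
  obtain ⟨b, hb0, hb, hsum⟩ := exists_excess hε fun x hx => hd.trans (hg x hx)
  have h1 := (ternarySum_formResidue _ (zmod_three_val_mem (hε0 0)) _ (zmod_three_val_mem (hε0 1))
      _ (zmod_three_val_mem (hε0 2)) _ (zmod_three_val_mem (hε0 3))).1
  have hd0 : (27 * s + 3) % 3 = 0 := by omega
  have h2 := sum_weightResidue ε (27 * s + 3)
  rw [hd0, h1] at h2
  -- Here 54n - 80d = 84, which rules out 90; the remaining 12 gives ∑ b ≤ 4.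
  have h72 : ∑ x, weightResidue ε (27 * s + 3) x = 72 := by
    split_ifs at h2 <;> omega
  refine false_of_excess_le_four hε0 hb0 (fun x => ?_) (by omega)
    (excess_dual_form hε0 (by omega) h72 hb)
  by_cases hx : x = 0
  · simp [hx]
  · have h3 := hb x hx
    have h4 := hb (-x) (neg_ne_zero.2 hx)
    rw [columnWeight_neg] at h4
    have h5 : weightResidue ε (27 * s + 3) (-x) = weightResidue ε (27 * s + 3) x := by
      have := weightResidue_cast ε (27 * s + 3) (-x)
      simp only [Pi.neg_apply, neg_sq] at this
      rw [← weightResidue_cast, ZMod.natCast_eq_natCast_iff', Nat.mod_eq_of_lt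
        (weightResidue_lt _ _ _), Nat.mod_eq_of_lt (weightResidue_lt _ _ _)] at this
      exact this
    omega

/-! ### Codes from digit-encoded columns -/

/-- The vector with the base `3` digits of `t` as its entries. -/
def digitColumn (t : ℕ) : Fin 4 → ZMod 3 := fun i => ((t / 3 ^ (i : ℕ) : ℕ) : ZMod 3)

/-- The weight of the combination with coefficients `a, b, c, d` of the rows of the matrix with
columns `digitColumn t`, for `t` in `L`. -/
def digitWeight (L : List ℕ) (a b c d : ℕ) : ℕ :=
  (L.map fun t => (a * t + b * (t / 3) + c * (t / 9) + d * (t / 27)) ^ 2 % 3).sum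

/-- The entries of the Gram matrix of the rows of the matrix with columns `digitColumn t`, for `t`
in `L`. -/
def digitGram (L : List ℕ) (i j : ℕ) : ℕ := (L.map fun t => (t / 3 ^ i) * (t / 3 ^ j)).sum % 3

/-- The columns `digitColumn t` with `t` in `L` generate a code with orthogonal anisotropic rows
and with minimum weight at least `m`. -/
def IsDigitGenerator (L : List ℕ) (m : ℕ) : Prop :=
  (∀ a < 3, ∀ b < 3, ∀ c < 3, ∀ d < 3, a + b + c + d ≠ 0 → m ≤ digitWeight L a b c d) ∧
  ∀ i < 4, ∀ j < 4, (digitGram L i j = 0 ↔ i ≠ j)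

instance (L : List ℕ) (m : ℕ) : Decidable (IsDigitGenerator L m) := by
  unfold IsDigitGenerator; infer_instance

/-- One column for each point of the projective space. -/
def simplexColumns : List ℕ :=
  [1, 3, 4, 7, 9, 10, 12, 13, 16, 19, 21, 22, 25, 27, 28, 30, 31, 34, 36, 37, 39, 40, 43, 46, 48,
   49, 52, 55, 57, 58, 61, 63, 64, 66, 67, 70, 73, 75, 76, 79]

theorem simplexColumns_spec :
    (∀ a < 3, ∀ b < 3, ∀ c < 3, ∀ d < 3, a + b + c + d ≠ 0 →
      27 ≤ digitWeight simplexColumns a b c d) ∧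
    ∀ i < 4, ∀ j < 4, digitGram simplexColumns i j = 0 := by
  decide +kernel

theorem IsDigitGenerator.append_simplexColumns {L : List ℕ} {m : ℕ} (h : IsDigitGenerator L m) :
    IsDigitGenerator (simplexColumns ++ L) (27 + m) := by
  refine ⟨fun a ha b hb c hc d hd h0 => ?_, fun i hi j hj => ?_⟩
  · have h1 := simplexColumns_spec.1 a ha b hb c hc d hd h0
    have h2 := h.1 a ha b hb c hc d hd h0
    simp only [digitWeight, List.map_append, List.sum_append] at *
    omega
  · have h1 := simplexColumns_spec.2 i hi j hj
    rw [← h.2 i hi j hj]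
    simp only [digitGram, List.map_append, List.sum_append] at *
    omega

theorem IsDigitGenerator.exists_add_mul {L : List ℕ} {m : ℕ} (h : IsDigitGenerator L m) (s : ℕ) :
    ∃ L', L'.length = 40 * s + L.length ∧ IsDigitGenerator L' (27 * s + m) := by
  induction s with
  | zero => exact ⟨L, by simp, by simpa using h⟩
  | succ s ih =>
    obtain ⟨L', hL, hL'⟩ := ih
    refine ⟨simplexColumns ++ L', ?_, ?_⟩
    · rw [List.length_append, hL, show simplexColumns.length = 40 from rfl]; ring
    · convert hL'.append_simplexColumns using 1; ring

theorem digitColumn_dotProduct (x : Fin 4 → ZMod 3) (t : ℕ) : x ⬝ᵥ digitColumn t =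
    (((x 0).val * t + (x 1).val * (t / 3) + (x 2).val * (t / 9) + (x 3).val * (t / 27) : ℕ) :
      ZMod 3) := by
  simp [dotProduct, Fin.sum_univ_four, digitColumn]

/-- The code generated by a matrix with given columns. -/
theorem IsDigitGenerator.exists_code {L : List ℕ} {m : ℕ} (h : IsDigitGenerator L m)
    (hm : 0 < m) : ∃ w ∈ lcdMinWeights (ZMod 3) L.length 4, m ≤ w := by
  let g : Fin L.length → Fin 4 → ZMod 3 := fun k => digitColumn (L.get k)
  let T : (Fin 4 → ZMod 3) →ₗ[ZMod 3] (Fin L.length → ZMod 3) := (Matrix.of g).mulVecLin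
  have hT : ∀ x k, T x k = x ⬝ᵥ g k := fun x k => dotProduct_comm (g k) x
  have hwt : ∀ x, hammingNorm (T x) =
      digitWeight L (x 0).val (x 1).val (x 2).val (x 3).val := by
    intro x
    have hsq : ∀ a : ZMod 3, (a ^ 2).val = if a ≠ 0 then 1 else 0 := by decide
    rw [hammingNorm, card_filter, digitWeight, ← Fin.sum_univ_fun_getElem]
    refine Finset.sum_congr rfl fun k _ => ?_
    rw [← hsq, hT, digitColumn_dotProduct, ← Nat.cast_pow, ZMod.val_natCast]
    rfl
  have hge : ∀ x, x ≠ 0 → m ≤ hammingNorm (T x) := by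
    intro x hx
    rw [hwt]
    refine h.1 _ (ZMod.val_lt _) _ (ZMod.val_lt _) _ (ZMod.val_lt _) _ (ZMod.val_lt _) ?_
    contrapose! hx
    have hv : ∀ i, (x i).val = 0 := by
      intro i; fin_cases i <;> simp <;> first | omega | simp_all
    exact funext fun i => (ZMod.val_eq_zero _).1 (hv i)
  have hinj : Function.Injective T := by
    refine (injective_iff_map_eq_zero T).2 fun x hx => ?_
    by_contra h0
    have := hge x h0
    rw [hx, hammingNorm_zero] at this
    omega
  have hgram : ∀ i j : Fin 4, ∑ k, g k i * g k j = (digitGram L i j : ZMod 3) := by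
    intro i j
    rw [digitGram, ZMod.natCast_mod, ← Fin.sum_univ_fun_getElem, Nat.cast_sum]
    exact Finset.sum_congr rfl fun k _ => by simp [g, digitColumn]
  have hgram0 : ∀ i j : Fin 4, ∑ k, g k i * g k j = 0 ↔ i ≠ j := by
    intro i j
    rw [hgram, ZMod.natCast_eq_zero_iff, Nat.dvd_iff_mod_eq_zero]
    have h1 := h.2 i i.2 j j.2
    rw [show digitGram L i j % 3 = digitGram L i j from Nat.mod_mod _ _, h1, ne_eq, Fin.val_inj]
  refine ⟨_, ⟨LinearMap.range T, ?_, ?_, rfl⟩, ?_⟩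
  · rw [LinearMap.finrank_range_of_inj hinj, Module.finrank_fin_fun]
  · rw [LinearCode.IsLCD, Submodule.eq_bot_iff]
    rintro _ ⟨⟨x, rfl⟩, hd⟩
    suffices x = 0 by rw [this, map_zero]
    refine funext fun i => ?_
    have h1 : ∑ k, T x k * T (Pi.single i 1) k = 0 := hd _ ⟨_, rfl⟩
    have h2 : ∑ k, T x k * T (Pi.single i 1) k = x i * ∑ k, g k i * g k i := by
      have : ∑ k, T x k * T (Pi.single i 1) k = ∑ j, x j * ∑ k, g k j * g k i := by
        have hs : ∀ k, T (Pi.single i 1) k = g k i := fun k => by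
          rw [hT, single_one_dotProduct]
        simp only [hs, hT, dotProduct, Finset.sum_mul, Finset.mul_sum]
        rw [Finset.sum_comm]
        exact Finset.sum_congr rfl fun j _ => Finset.sum_congr rfl fun k _ => by ring
      rw [this, Finset.sum_eq_single i _ (by simp)]
      intro j _ hji
      rw [(hgram0 j i).2 hji, mul_zero]
    rw [h2] at h1
    exact (mul_eq_zero.1 h1).resolve_right fun h3 => (hgram0 i i).1 h3 rfl
  · obtain ⟨i⟩ : Nonempty (Fin 4) := inferInstance
    -- Nonemptiness matters: `sInf` of the empty set would be 0.
    have hne : T (Pi.single i 1) ≠ 0 := fun h0 =>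
      one_ne_zero (Pi.single_eq_zero_iff.1 (hinj (h0.trans (map_zero T).symm)))
    refine le_csInf ⟨_, T (Pi.single i 1), ⟨_, rfl⟩, hne, rfl⟩ ?_
    rintro _ ⟨_, ⟨x, rfl⟩, hx, rfl⟩
    exact hge x fun h0 => hx (by rw [h0, map_zero])

theorem IsDigitGenerator.le_largestLCDMinWeight {L : List ℕ} {m : ℕ}
    (h : IsDigitGenerator L m) (hm : 0 < m) (s : ℕ) :
    27 * s + m ≤ largestLCDMinWeight (ZMod 3) (40 * s + L.length) 4 := by
  obtain ⟨L', hL, hL'⟩ := h.exists_add_mul s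
  obtain ⟨w, hw, hmw⟩ := hL'.exists_code (by omega)
  rw [← hL]
  exact hmw.trans (le_csSup (bddAbove_lcdMinWeights _ _ _) hw)

theorem largestLCDMinWeight_lt {n k m : ℕ} (hm : 0 < m)
    (h : ∀ C : LinearCode (ZMod 3) n, Module.finrank (ZMod 3) C = k → C.IsLCD →
      C.minWeight < m) : largestLCDMinWeight (ZMod 3) n k < m := by
  by_contra! hle
  obtain ⟨⟨C, hk, hC, hw⟩, -⟩ := isGreatest_largestLCDMinWeight (ZMod 3) n k (by omega)
  have := h C hk hC
  omega

/-! ### Explicit codes and conclusion -/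

/-- Columns of a generator matrix of length `r` for the codes of largest minimum weight. -/
def optimalColumns : ℕ → List ℕ
  | 4 =>
    [31, 38, 47, 59]
  | 5 =>
    [18, 40, 52, 70, 76]
  | 6 =>
    [4, 34, 39, 52, 63, 80]
  | 7 =>
    [11, 18, 57, 61, 73, 76, 78]
  | 8 =>
    [9, 23, 26, 29, 48, 66, 72, 74]
  | 10 =>
    [2, 26, 27, 30, 34, 35, 63, 70, 76, 79]
  | 11 =>
    [13, 17, 21, 25, 32, 35, 37, 39, 42, 59, 60]
  | 14 =>
    [2, 3, 13, 17, 19, 24, 34, 36, 46, 51, 61, 63, 73, 78]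
  | 16 =>
    [8, 9, 17, 19, 25, 30, 31, 35, 37, 43, 46, 50, 61, 64, 67, 68]
  | 17 =>
    [6, 14, 26, 30, 35, 38, 45, 55, 56, 57, 59, 64, 65, 66, 74, 75, 78]
  | 19 =>
    [1, 3, 8, 12, 20, 22, 27, 31, 33, 34, 36, 39, 43, 44, 51, 56, 63, 68, 70]
  | 20 =>
    [2, 4, 5, 9, 21, 25, 26, 30, 36, 37, 42, 43, 49, 52, 53, 55, 56, 63, 70, 80]
  | 24 =>
    [4, 7, 13, 17, 21, 23, 24, 25, 29, 36, 37, 40, 41, 44, 46, 47, 50, 56, 63, 67, 68, 71, 73, 77]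
  | 26 =>
    [2, 7, 10, 12, 17, 18, 19, 21, 23, 26, 27, 30, 32, 34, 35, 38, 42, 46, 57, 62, 63, 71, 72, 74,
     77, 78]
  | 29 =>
    [2, 3, 4, 12, 15, 16, 19, 20, 25, 34, 37, 38, 43, 47, 48, 49, 50, 55, 56, 61, 65, 66, 67, 68,
     75, 76, 78, 79, 80]
  | 30 =>
    [2, 6, 8, 9, 11, 13, 14, 15, 16, 17, 28, 29, 30, 31, 36, 37, 38, 39, 42, 44, 57, 58, 59, 61,
     63, 64, 65, 66, 69, 71]
  | 33 =>
    [2, 4, 5, 9, 10, 11, 17, 21, 24, 25, 27, 28, 34, 40, 41, 43, 44, 46, 48, 49, 50, 57, 58, 60,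
     61, 62, 63, 64, 66, 67, 68, 72, 73]
  | 35 =>
    [1, 3, 4, 7, 7, 11, 14, 16, 16, 17, 21, 24, 26, 27, 30, 32, 33, 37, 40, 47, 49, 50, 52, 53,
     58, 58, 59, 62, 66, 69, 73, 75, 76, 78, 79]
  | 36 =>
    [2, 3, 5, 8, 9, 11, 14, 15, 17, 20, 23, 24, 26, 27, 30, 33, 36, 37, 39, 43, 45, 48, 49, 52,
     55, 56, 58, 59, 64, 65, 67, 70, 73, 76, 79, 80]
  | 38 =>
    [2, 3, 5, 5, 8, 9, 10, 12, 13, 15, 16, 19, 22, 28, 29, 30, 31, 32, 33, 34, 36, 37, 38, 39, 40,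
     41, 42, 43, 43, 45, 45, 46, 47, 49, 50, 51, 52, 53]
  | 39 =>
    [2, 3, 7, 8, 9, 10, 11, 12, 13, 14, 16, 16, 17, 17, 29, 30, 31, 36, 37, 38, 39, 41, 42, 43,
     44, 54, 56, 57, 57, 58, 61, 63, 63, 64, 67, 68, 69, 70, 71]
  | _ => []

theorem optimalColumns_spec : ∀ r ∈ [4, 5, 6, 7, 8, 10, 11, 14, 16, 17, 19, 20, 24, 26, 29, 30, 33,
      35, 36, 38, 39], (optimalColumns r).length = r ∧
    IsDigitGenerator (optimalColumns r) (27 * r / 40 - if r = 6 then 2 else 1) := by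
  decide +kernel

theorem mainTheorem2 (n : ℕ) (hn : 4 ≤ n) :
    (n % 40 ∈ ({4, 5, 7, 8, 10, 11, 14, 16, 17, 19, 20, 24, 26, 29, 30, 33, 35, 36, 38, 39} :
        Finset ℕ) →
      (largestLCDMinWeight (ZMod 3) n 4 : ℤ) = ⌊(27 * (n : ℚ)) / 40⌋ - 1) ∧
    (n % 40 = 6 →
      (largestLCDMinWeight (ZMod 3) n 4 : ℤ) = ⌊(27 * (n : ℚ)) / 40⌋ - 2) := by
  have hfloor : ⌊(27 * (n : ℚ)) / 40⌋ = ((27 * n / 40 : ℕ) : ℤ) := by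
    have := Rat.floor_natCast_div_natCast (27 * n) 40
    push_cast at this ⊢
    exact this
  rw [hfloor]
  have hdiv : 40 * (n / 40) + n % 40 = n := Nat.div_add_mod n 40
  generalize n / 40 = s at hdiv
  constructor
  · intro hr
    have h6 : n % 40 ≠ 6 := by
      intro h; rw [h] at hr; revert hr; decide
    have hmem : n % 40 ∈ [4, 5, 6, 7, 8, 10, 11, 14, 16, 17, 19, 20, 24, 26, 29, 30, 33,
        35, 36, 38, 39] := by
      simp only [Finset.mem_insert, Finset.mem_singleton] at hr
      simp only [List.mem_cons, List.not_mem_nil, or_false]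
      tauto
    obtain ⟨hlen, hspec⟩ := optimalColumns_spec _ hmem
    rw [if_neg h6] at hspec
    have hr4 : 4 ≤ n % 40 := by
      revert hr; generalize n % 40 = r; revert r; decide
    have hlow := hspec.le_largestLCDMinWeight (by omega) s
    rw [hlen, hdiv] at hlow
    have hup : largestLCDMinWeight (ZMod 3) n 4 < 27 * n / 40 := by
      refine largestLCDMinWeight_lt (by omega) fun C hk hC => ?_
      by_contra! hle
      have hb := hC.weight_bound hk hle
      simp only [Finset.mem_insert, Finset.mem_singleton] at hr
      generalize n % 40 = r at *
      subst hdiv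
      have hq : 27 * (40 * s + r) / 40 = 27 * s + 27 * r / 40 := by omega
      rw [hq] at hb
      rcases hr with rfl | rfl | rfl | rfl | rfl | rfl | rfl | rfl | rfl | rfl | rfl | rfl | rfl |
        rfl | rfl | rfl | rfl | rfl | rfl | rfl <;> norm_num at hb <;> split_ifs at hb <;> omega
    omega
  · intro hr
    obtain ⟨hlen, hspec⟩ := optimalColumns_spec 6 (by decide)
    have hlow := hspec.le_largestLCDMinWeight (by decide) s
    rw [hr] at hdiv
    rw [hlen, hdiv] at hlow
    -- The floor is 27s + 4 here, so this excludes the floor minus one as well.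
    have hup : largestLCDMinWeight (ZMod 3) n 4 < 27 * s + 3 := by
      subst hdiv
      exact largestLCDMinWeight_lt (by omega) fun C hk hC => hC.minWeight_lt hk
    norm_num at hlow
    omega
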